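/- **Setting.** An MDP has a finite state space $S$, a finite nonempty action space $A$, transition function $P:S\times A\to\Delta(S)$, reward $R:S\times A\to\mathbb{R}$, finite horizon $H\ge 1$, and an initial state $s_0$; $S$ is partitioned into $S_0,\dots,S_H$, with $s_0\in S_0$, and states in $S_h$ $(h<H)$ only transition to states in $S_{h+1}$. For a policy $\pi:S\to\Delta(A)$, $V^\pi_M(s_0)$ is the expected total reward over times $0,\dots,H-1$. *Provider.* $M^{\rm p}$ is an MDP whose states carry a binary feature $u\in\{u^-,u^+\}$, equal to $u^-$ in $s^{\rm p}_0$, and permanent once equal to $u^+$. Let $\mathcal T=\{1,\dots,H\}$. A commitment $c=(T,p)\in\mathcal T\times[0,1]$ is *feasible* if some provider policy $\pi$ has $\Pr(u^+\in s_T\mid s^{\rm p}_0,\pi)\ge p$. The provider's value $v^{\rm p}(T,p)$ of a feasible commitment is the maximum of $V^{\pi}_{M^{\rm p}}(s^{\rm p}_0)$ over the policies $\pi$ with this property. Let $\overline p(T)$ be the maximum feasible probability for $T$. The *breakpoints* $\mathcal P(T)$ are $0$, $\overline p(T)$, and the points of $(0,\overline p(T))$ at which the slope of $v^{\rm p}(T,\cdot)$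 changes. Let $\mathcal C=\{(T,p):T\in\mathcal T,\ p\in\mathcal P(T)\}$. *Recipient.* A recipient MDP has the same horizon $H$ and states $(l,u)$, initially with $u=u^-$, and transitions $P((l',u')\mid(l,u),a)=P_u(u'\mid u)\,P_l(l'\mid(l,u),a)$. The recipient's value $v^{\rm r}(c)$ of $c=(T,p)$ is its optimal initial value when the dynamics $P_u$ are replaced by a single branch: $u$ flips from $u^-$ to $u^+$ with probability $p$ on reaching time $T$, at no other time, and stays $u^+$ once flipped. Let $v^{\rm p+r}=v^{\rm p}+v^{\rm r}$. *Queries.* Let $\mu$ be a probability distribution over a finite set of candidate recipient MDPs, and $EU(c;\mu)=\mathbb E_\mu[v^{\rm p+r}(c)]$. A query $\mathcal Q=(c_1,\dots,c_k)$ is a list of $k\ge1$ feasible commitments; the recipient responds with the $c_j$ that maximizes $v^{\rm p+r}$, ties being broken by the smallest index. With $\mu\mid\mathcal Q\rightsquigarrow c_j$ the posterior of $\mu$ given this response, $$EUS(\mathcal Q;\mu)=\sum_{j=1}^{k}\Pr_\mu(\mathcal Q\rightsquigarrow c_j)\;EU(c_j;\ \mu\mid\mathcal Q\rightsquigarrow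 c_j).$$ **Theorem.** Let $k\ge1$ and let $\mu$ be any such distribution. 1. If $k\le|\mathcal C|$, then, over queries of exactly $k$ distinct commitments, both maxima below are attained and $$\max_{\mathcal Q\subseteq\mathcal T\times[0,1]\text{ feasible},\ |\mathcal Q|=k}EUS(\mathcal Q;\mu)=\max_{\mathcal Q\subseteq\mathcal C,\ |\mathcal Q|=k}EUS(\mathcal Q;\mu).$$ 2. For every $k\ge 1$ the same holds, with both maxima attained, over queries $(c_1,\dots,c_k)$ in which commitments may be repeated (that is, queries of at most $k$ distinct commitments). -/

import Mathlib

open scoped Topology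

/-- A finite-horizon Markov decision process with finite state space `S`, finite action space `A`
and horizon `H`.  The state space is partitioned by the time step: `layer s = h` says `s ∈ S_h`.
States of `S_h` with `h < H` only transition to states of `S_{h+1}`; the process starts in `init`
and ends when it reaches `S_H`. -/
structure MDP (S A : Type*) [Fintype S] [Fintype A] (H : ℕ) where
  layer : S → ℕ
  layer_le : ∀ s, layer s ≤ H
  trans : S → A → stdSimplex ℝ S
  trans_layer : ∀ s a s', layer s < H → 0 < (trans s a).1 s' → layer s' = layer s + 1
  reward : S → A → ℝ
  init : S
  init_layer : layer init = 0

/-- Stochastic Markov policies `π : S → Δ(A)`. -/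
abbrev Policy (S A : Type*) [Fintype A] := S → stdSimplex ℝ A

namespace MDP

variable {S A : Type*} [Fintype S] [Fintype A] {H : ℕ}

open Classical in
/-- `M.stateDist π s t s'` is the probability of being in `s'` after `t` transitions under the
policy `π`, starting from `s`. -/
noncomputable def stateDist (M : MDP S A H) (π : Policy S A) (s : S) : ℕ → S → ℝ
  | 0 => fun s' => if s' = s then 1 else 0
  | t + 1 => fun s' => ∑ x, ∑ a, stateDist M π s t x * (π x).1 a * (M.trans x a).1 s'

/-- The value `V^π_M(s)`: the expected sum of the rewards collected from `s` (at time
`layer s`) through time `H - 1`. -/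
noncomputable def value (M : MDP S A H) (π : Policy S A) (s : S) : ℝ :=
  ∑ t ∈ Finset.range (H - M.layer s),
    ∑ x, ∑ a, M.stateDist π s t x * (π x).1 a * M.reward x a

end MDP

/-- A commitment `c = (T, p)` with time `T ∈ {1, …, H}` and probability `p ∈ [0, 1]`. -/
abbrev Commitment (H : ℕ) := Set.Icc 1 H × Set.Icc (0 : ℝ) 1

/-- The provider's MDP: an MDP whose states carry the binary feature `u`, where `enabled s` says
that `u = u⁺` in `s`.  Initially `u = u⁻`, and once `u` is `u⁺` it stays `u⁺`. -/
structure ProviderMDP (S A : Type*) [Fintype S] [Fintype A] (H : ℕ) extends MDP S A H where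
  enabled : S → Bool
  init_enabled : enabled init = false
  enabled_permanent : ∀ s a s', layer s < H → 0 < (trans s a).1 s' →
    enabled s = true → enabled s' = true

namespace ProviderMDP

variable {S A : Type*} [Fintype S] [Fintype A] {H : ℕ}

/-- `Pr (u⁺ ∈ s_T | s₀, π)`. -/
noncomputable def enableProb (M : ProviderMDP S A H) (π : Policy S A) (T : ℕ) : ℝ :=
  ∑ s, if M.enabled s = true then M.toMDP.stateDist π M.init T s else 0

/-- The commitment `c` is feasible: some policy respects its semantics. -/
def Feasible (M : ProviderMDP S A H) (c : Commitment H) : Prop :=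
  ∃ π : Policy S A, (c.2 : ℝ) ≤ M.enableProb π (c.1 : ℕ)

/-- The provider's commitment value `v^p(T, p)`: the maximal initial value over the policies that
respect the commitment. -/
noncomputable def commitmentValue (M : ProviderMDP S A H) (T : ℕ) (p : ℝ) : ℝ :=
  sSup {x | ∃ π : Policy S A, p ≤ M.enableProb π T ∧ M.toMDP.value π M.init = x}

/-- The maximum feasible probability for the commitment time `T`. -/
noncomputable def maxProb (M : ProviderMDP S A H) (T : ℕ) : ℝ :=
  ⨆ π : Policy S A, M.enableProb π T

/-- The provider's linearity breakpoints for the time `T`: the two extremes `0` and `maxProb T`,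
and the probabilities strictly between them at which the slope of `v^p(T, ·)` changes, i.e. around
which `v^p(T, ·)` is not given by a single affine function. -/
def breakpoints (M : ProviderMDP S A H) (T : ℕ) : Set ℝ :=
  {p | p = 0 ∨ p = M.maxProb T ∨
    (0 < p ∧ p < M.maxProb T ∧
      ¬ ∃ a b : ℝ, ∀ᶠ q in 𝓝 p, M.commitmentValue T q = a + b * q)}

/-- The set of the commitments whose probability is a breakpoint for their time. -/
def breakpointCommitments (M : ProviderMDP S A H) : Set (Commitment H) :=
  {c | (c.2 : ℝ) ∈ M.breakpoints (c.1 : ℕ)}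

end ProviderMDP

/-- Dynamics of the feature `u` as seen by the recipient (`true` is `u⁺`): the distribution of the
feature at time `h + 1`, given the time `h` and the value of the feature at time `h`. -/
abbrev Influence := ℕ → Bool → stdSimplex ℝ Bool

/-- The recipient's MDP, up to the dynamics of `u`.  Its states are the pairs `(l, u)` of the
locally controlled features `l : L` and the shared feature `u`, which is `u⁻` initially.
Supplying the dynamics of `u` completes it to an MDP, see `RecipientMDP.toMDP`. -/
structure RecipientMDP (L A : Type*) [Fintype L] [Fintype A] (H : ℕ) where
  layer : L → ℕ
  layer_le : ∀ l, layer l ≤ H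
  localTrans : L × Bool → A → stdSimplex ℝ L
  localTrans_layer : ∀ s a l', layer s.1 < H → 0 < (localTrans s a).1 l' →
    layer l' = layer s.1 + 1
  reward : L × Bool → A → ℝ
  init : L
  init_layer : layer init = 0

/-- The recipient's hypothesized influence for the commitment `c = (T, p)`: a single branch, in
which `u` flips from `u⁻` to `u⁺` with probability `p` on the transition into time `T`, and at no
other time; `u⁺` is permanent. -/
noncomputable def singleBranch {H : ℕ} (c : Commitment H) : Influence := fun h u =>
  let q : ℝ := if u = true then 1 else if h + 1 = (c.1 : ℕ) then (c.2 : ℝ) else 0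
  ⟨fun u' => if u' = true then q else 1 - q, by
    have hq : 0 ≤ q ∧ q ≤ 1 := by
      simp only [q]
      split_ifs
      · exact ⟨zero_le_one, le_refl _⟩
      · exact ⟨c.2.2.1, c.2.2.2⟩
      · exact ⟨le_refl _, zero_le_one⟩
    refine ⟨fun u' => ?_, ?_⟩
    · cases u'
      · simpa using hq.2
      · simpa using hq.1
    · simp⟩

namespace RecipientMDP

variable {L A : Type*} [Fintype L] [Fintype A] {H : ℕ}

/-- The recipient's MDP with the dynamics of `u` given by `w`: the transition probabilities are
`P((l', u') | (l, u), a) = P_u(u' | u) * P_l(l' | (l, u), a)`. -/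
noncomputable def toMDP (M : RecipientMDP L A H) (w : Influence) : MDP (L × Bool) A H where
  layer s := M.layer s.1
  layer_le s := M.layer_le s.1
  trans s a := ⟨fun s' => (w (M.layer s.1) s.2).1 s'.2 * (M.localTrans s a).1 s'.1, by
    refine ⟨fun s' => mul_nonneg ((w _ _).2.1 _) ((M.localTrans s a).2.1 _), ?_⟩
    rw [Fintype.sum_prod_type_right]
    simp_rw [← Finset.mul_sum]
    rw [(M.localTrans s a).2.2]
    simpa using (w (M.layer s.1) s.2).2.2⟩
  trans_layer s a s' hs h := M.localTrans_layer s a s'.1 hs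
    (pos_of_mul_pos_right h ((w _ _).2.1 _))
  reward := M.reward
  init := (M.init, false)
  init_layer := M.init_layer

/-- The recipient's commitment value `v^r(c)`: the optimal initial value in the approximate model
for the commitment `c`. -/
noncomputable def commitmentValue (M : RecipientMDP L A H) (c : Commitment H) : ℝ :=
  ⨆ π : Policy (L × Bool) A,
    (M.toMDP (singleBranch c)).value π (M.toMDP (singleBranch c)).init

end RecipientMDP

/-- The joint commitment value `v^{p+r}(c) = v^p(c) + v^r(c)`. -/
noncomputable def jointValue {S A L B : Type*} [Fintype S] [Fintype A] [Fintype L] [Fintype B]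
    {H : ℕ} (P : ProviderMDP S A H) (R : RecipientMDP L B H) (c : Commitment H) : ℝ :=
  P.commitmentValue (c.1 : ℕ) (c.2 : ℝ) + R.commitmentValue c

section Query

/-! Below, `ι` indexes the candidate recipient MDPs, `v i c` is the joint value of the commitment
`c` if candidate `i` is the true one, `μ` is a distribution on `ι`, and a query is given by its
list `Q 0, …, Q (k - 1)` of commitments. -/

variable {ι K : Type*} [Fintype ι] {k : ℕ}

/-- The expected utility `EU(c; μ)`. -/
def EU (v : ι → K → ℝ) (μ : ι → ℝ) (c : K) : ℝ := ∑ i, μ i * v i c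

/-- A recipient for whom the joint values are `w` responds to `Q` with the `j`-th commitment: it
maximizes `w`, and has the smallest index among the maximizers. -/
def IsResponse (w : K → ℝ) (Q : Fin k → K) (j : Fin k) : Prop :=
  (∀ j', w (Q j') ≤ w (Q j)) ∧ ∀ j' < j, w (Q j') < w (Q j)

open Classical in
/-- The joint probability under `μ` that `i` is the true candidate and the response is `j`. -/
noncomputable def responseJoint (v : ι → K → ℝ) (μ : ι → ℝ) (Q : Fin k → K) (j : Fin k)
    (i : ι) : ℝ :=
  if IsResponse (v i) Q j then μ i else 0

/-- The probability under `μ` that the response is `j`. -/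
noncomputable def responseProb (v : ι → K → ℝ) (μ : ι → ℝ) (Q : Fin k → K) (j : Fin k) : ℝ :=
  ∑ i, responseJoint v μ Q j i

/-- The posterior on the candidates given the response `j`, by Bayes' rule.  (Responses of
probability zero get weight zero in `EUS`.) -/
noncomputable def posterior (v : ι → K → ℝ) (μ : ι → ℝ) (Q : Fin k → K) (j : Fin k) : ι → ℝ :=
  fun i => responseJoint v μ Q j i / responseProb v μ Q j

/-- The expected utility of selection `EUS(Q; μ)`: the expectation, over the response, of the
expected utility of the selected commitment under the posterior given the response. -/
noncomputable def EUS (v : ι → K → ℝ) (μ : ι → ℝ) (Q : Fin k → K) : ℝ :=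
  ∑ j, responseProb v μ Q j * EU v (posterior v μ Q j) (Q j)

end Query

/-!
For a query `Q` the expected utility of selection is the expectation, over the candidate `i`, of
the maximum of the joint values `v i (Q j)` (`EUS_eq_sum_iSup`).  It is therefore convex along any
chord on which all the joint values are convex, and an entry of the query that lies on such a chord
can be moved to one of the two ends without loss (`exists_EUS_le_of_chord`).  The chords are those
between consecutive breakpoints for the same time:

* The value of the recipient is convex in the probability `p` of the commitment, as a supremum over
  the policies of functions affine in `p` (`RecipientMDP.commitmentValue_le_chord`): the probability
  enters a trajectory only once, in the transition into the time `T`.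
* The value of the provider is affine between breakpoints, of which there are finitely many.  The
  occupancy measures of the policies form a polytope whose vertices are deterministic, so the pairs
  of enabling probability and value form a polygon (`ProviderMDP.range_performance`), and the value
  of a commitment is the upper boundary of this polygon.  It is concave and decreasing, changes its
  slope only at abscissas of vertices (`upperValue_locallyAffineAt`), and by compactness does not
  drop at the end of an interval on which it is affine (`affine_le_upperValue_right`).

Moving all the entries yields a query of breakpoint commitments.  If distinct entries are required,
repetitions are replaced by other breakpoint commitments, which does not decrease a maximum
(`exists_embedding_EUS_le`).  The maxima are attained because there are only finitely many queries
of breakpoint commitments.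
-/

/-! ### Locally affine functions of one variable -/

/-- The function `f` is given by a single affine function in a neighbourhood of `p`. -/
def LocallyAffineAt (f : ℝ → ℝ) (p : ℝ) : Prop :=
  ∃ a b : ℝ, ∀ᶠ q in 𝓝 p, f q = a + b * q

theorem hasDerivAt_of_eventuallyEq_affine {f : ℝ → ℝ} {a b p : ℝ}
    (h : ∀ᶠ q in 𝓝 p, f q = a + b * q) : HasDerivAt f b p := by
  have h1 : HasDerivAt (fun q : ℝ => a + b * q) b p := by
    simpa using ((hasDerivAt_id p).const_mul b).const_add a
  exact h1.congr_of_eventuallyEq h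

/-- A function that is locally affine at every point of an open interval is affine on it: its
derivative is locally constant, hence constant. -/
theorem exists_affine_of_locallyAffineAt {f : ℝ → ℝ} {l r : ℝ}
    (h : ∀ p ∈ Set.Ioo l r, LocallyAffineAt f p) :
    ∃ a b : ℝ, ∀ p ∈ Set.Ioo l r, f p = a + b * p := by
  rcases (Set.Ioo l r).eq_empty_or_nonempty with he | ⟨c, hc⟩
  · exact ⟨0, 0, by simp [he]⟩
  have hd : ∀ p ∈ Set.Ioo l r, HasDerivAt (deriv f) 0 p := by
    intro p hp
    obtain ⟨a, b, hab⟩ := h p hp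
    have h2 : deriv f =ᶠ[𝓝 p] fun _ => b := by
      filter_upwards [hab.eventually_nhds] with q hq
      exact (hasDerivAt_of_eventuallyEq_affine hq).deriv
    exact (hasDerivAt_const p b).congr_of_eventuallyEq h2
  have hconst : ∀ p ∈ Set.Ioo l r, deriv f p = deriv f c := fun p hp =>
    isOpen_Ioo.is_const_of_deriv_eq_zero isPreconnected_Ioo
      (fun q hq => (hd q hq).differentiableAt.differentiableWithinAt)
      (fun q hq => (hd q hq).deriv) hp hc
  have hg : ∀ p ∈ Set.Ioo l r, HasDerivAt (fun q => f q - deriv f c * q) 0 p := by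
    intro p hp
    obtain ⟨a, b, hab⟩ := h p hp
    have h1 := (hasDerivAt_of_eventuallyEq_affine hab).differentiableAt.hasDerivAt
    rw [hconst p hp] at h1
    simpa using h1.fun_sub ((hasDerivAt_id p).const_mul (deriv f c))
  refine ⟨f c - deriv f c * c, deriv f c, fun p hp => ?_⟩
  have := isOpen_Ioo.is_const_of_deriv_eq_zero isPreconnected_Ioo
      (fun q hq => (hg q hq).differentiableAt.differentiableWithinAt)
      (fun q hq => (hg q hq).deriv) hp hc
  linarith

/-! ### The upper boundary of a planar polygon -/

/-- The largest second coordinate of the points of `K` whose first coordinate is at least `p`. -/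
noncomputable def upperValue (K : Set (ℝ × ℝ)) (p : ℝ) : ℝ :=
  sSup {y | ∃ z ∈ K, p ≤ z.1 ∧ z.2 = y}

section UpperValue

variable {K : Set (ℝ × ℝ)} {z₀ : ℝ × ℝ}

theorem isGreatest_upperValue (hK : IsCompact K) (hz₀ : z₀ ∈ K) {p : ℝ} (hp : p ≤ z₀.1) :
    IsGreatest {y | ∃ z ∈ K, p ≤ z.1 ∧ z.2 = y} (upperValue K p) := by
  have heq : {y | ∃ z ∈ K, p ≤ z.1 ∧ z.2 = y} = Prod.snd '' (K ∩ {z | p ≤ z.1}) := by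
    ext y
    simp [and_assoc]
  have hc : IsCompact (Prod.snd '' (K ∩ {z : ℝ × ℝ | p ≤ z.1})) :=
    (hK.inter_right (isClosed_le continuous_const continuous_fst)).image continuous_snd
  rw [upperValue, heq]
  exact hc.isGreatest_sSup ⟨_, z₀, ⟨hz₀, hp⟩, rfl⟩

theorem le_upperValue (hK : IsCompact K) {z : ℝ × ℝ} (hz : z ∈ K) {p : ℝ} (hp : p ≤ z.1) :
    z.2 ≤ upperValue K p :=
  (isGreatest_upperValue hK hz hp).2 ⟨z, hz, hp, rfl⟩

theorem upperValue_antitoneOn (hK : IsCompact K) (hz₀ : z₀ ∈ K) :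
    AntitoneOn (upperValue K) (Set.Iic z₀.1) := by
  intro p _ q hq hpq
  obtain ⟨z, hz, hqz, h⟩ := (isGreatest_upperValue hK hz₀ hq).1
  exact h ▸ le_upperValue hK hz (hpq.trans hqz)

theorem upperValue_concaveOn (hK : IsCompact K) (hKc : Convex ℝ K) (hz₀ : z₀ ∈ K) :
    ConcaveOn ℝ (Set.Iic z₀.1) (upperValue K) := by
  refine ⟨convex_Iic _, fun p hp q hq a b ha hb hab => ?_⟩
  obtain ⟨z, hz, hpz, h⟩ := (isGreatest_upperValue hK hz₀ hp).1
  obtain ⟨w, hw, hqw, h'⟩ := (isGreatest_upperValue hK hz₀ hq).1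
  rw [← h, ← h']
  refine le_upperValue (z := a • z + b • w) hK (hKc hz hw ha hb hab) ?_
  simp only [smul_eq_mul, Prod.fst_add, Prod.smul_fst]
  gcongr

/-- Left upper semicontinuity of the upper boundary, in the form of a closing-up principle for
affine lower bounds.  The maximizers for `q < r` accumulate, by compactness, at a point
admissible for `r`. -/
theorem affine_le_upperValue_right (hK : IsCompact K) (hz₀ : z₀ ∈ K) {a b l r : ℝ} (hlr : l < r)
    (hr : r ≤ z₀.1) (h : ∀ q ∈ Set.Ioo l r, a + b * q ≤ upperValue K q) :
    a + b * r ≤ upperValue K r := by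
  obtain ⟨q, -, hq, hlim⟩ := exists_seq_strictMono_tendsto' hlr
  have hex : ∀ n, ∃ z ∈ K, q n ≤ z.1 ∧ z.2 = upperValue K (q n) := fun n =>
    (isGreatest_upperValue hK hz₀ ((hq n).2.le.trans hr)).1
  choose z hzK hzq hzv using hex
  obtain ⟨w, hw, φ, hφ, hφlim⟩ := hK.tendsto_subseq hzK
  have hqlim : Filter.Tendsto (q ∘ φ) Filter.atTop (𝓝 r) := hlim.comp hφ.tendsto_atTop
  have hw1 : r ≤ w.1 :=
    le_of_tendsto_of_tendsto' hqlim ((continuous_fst.tendsto w).comp hφlim) fun n => hzq (φ n)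
  have hw2 : a + b * r ≤ w.2 :=
    le_of_tendsto_of_tendsto' ((hqlim.const_mul b).const_add a)
      ((continuous_snd.tendsto w).comp hφlim) fun n => by
        simpa [hzv] using h _ (hq (φ n))
  exact hw2.trans (le_upperValue hK hw hw1)

/-- An antitone function dominates the limits from the right, so that an affine lower bound on
an open interval extends to its left end. -/
theorem affine_le_upperValue_left (hK : IsCompact K) (hz₀ : z₀ ∈ K) {a b l r : ℝ} (hlr : l < r)
    (hr : r ≤ z₀.1) (h : ∀ q ∈ Set.Ioo l r, a + b * q ≤ upperValue K q) :
    a + b * l ≤ upperValue K l := by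
  have hc : Filter.Tendsto (fun q : ℝ => a + b * q) (𝓝[>] l) (𝓝 (a + b * l)) :=
    (Continuous.tendsto (by fun_prop) l).mono_left nhdsWithin_le_nhds
  refine le_of_tendsto hc ?_
  filter_upwards [Ioo_mem_nhdsGT hlr] with q hq
  exact (h q hq).trans (upperValue_antitoneOn hK hz₀ (hlr.le.trans hr) (hq.2.le.trans hr) hq.1.le)

theorem exists_supporting_line {f : ℝ → ℝ} {m p : ℝ} (hf : ConcaveOn ℝ (Set.Iic m) f)
    (hp : p < m) : ∃ b : ℝ, ∀ q ≤ m, f q ≤ f p + b * (q - p) := by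
  have hp' : p ∈ interior (Set.Iic m) := by simpa using hp
  have hg : ConvexOn ℝ (Set.Iic m) (-f) := hf.neg
  refine ⟨-derivWithin (-f) (Set.Ioi p) p, fun q hq => ?_⟩
  rcases lt_trichotomy q p with h | rfl | h
  · have h1 := hg.slope_le_leftDeriv_of_mem_interior hq hp' h
    have h2 := h1.trans (hg.leftDeriv_le_rightDeriv_of_mem_interior hp')
    rw [slope_def_field, div_le_iff₀ (by linarith)] at h2
    simp only [Pi.neg_apply] at h2
    linarith
  · simp
  · have h1 := hg.rightDeriv_le_slope_of_mem_interior hp' hq h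
    rw [slope_def_field, le_div_iff₀ (by linarith)] at h1
    simp only [Pi.neg_apply] at h1
    linarith

/-- The upper boundary of a polygon can only change its slope at the abscissa of a vertex.  A
supporting line at `p` contains every vertex that enters the convex combination attaining the
boundary at `p`.  Either such vertices lie on both sides of `p`, and the line is the boundary
between them, or they all lie to the right of `p`, and the line is horizontal. -/
theorem upperValue_locallyAffineAt {D : Set (ℝ × ℝ)} (hD : D.Finite) (hz₀ : z₀ ∈ convexHull ℝ D)
    {p : ℝ} (hp : p < z₀.1) (hmax : ∀ z ∈ D, z.1 ≤ z₀.1) (hpD : ∀ z ∈ D, z.1 ≠ p) :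
    LocallyAffineAt (upperValue (convexHull ℝ D)) p := by
  set f := upperValue (convexHull ℝ D) with hf
  have hK : IsCompact (convexHull ℝ D) := hD.isCompact_convexHull ℝ
  have hKc : Convex ℝ (convexHull ℝ D) := convex_convexHull ℝ D
  obtain ⟨b, hb⟩ := exists_supporting_line (upperValue_concaveOn hK hKc hz₀) hp
  -- the function decreases, hence so does the supporting line
  have hb0 : b ≤ 0 := by
    have h1 := hb (p - 1) (by linarith)
    have h2 := upperValue_antitoneOn hK hz₀ (show p - 1 ∈ Set.Iic z₀.1 by simp; linarith)
      (show p ∈ Set.Iic z₀.1 from hp.le) (by linarith)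
    linarith
  obtain ⟨z, hz, hpz, hzv⟩ := (isGreatest_upperValue hK hz₀ hp.le).1
  have hD' : D = (hD.toFinset : Set (ℝ × ℝ)) := by simp
  have hz' := hz
  rw [hD', Finset.convexHull_eq] at hz'
  obtain ⟨w, hw0, hw1, hwz⟩ := hz'
  rw [Finset.centerMass_eq_of_sum_1 _ _ hw1] at hwz
  have hz1 : ∑ d ∈ hD.toFinset, w d * d.1 = z.1 := by
    rw [← hwz, Prod.fst_sum]; simp
  have hz2 : ∑ d ∈ hD.toFinset, w d * d.2 = z.2 := by
    rw [← hwz, Prod.snd_sum]; simp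
  have hgap : ∀ d ∈ hD.toFinset, 0 ≤ w d * (f p + b * (d.1 - p) - d.2) := by
    intro d hd
    have hdD : d ∈ D := by simpa using hd
    have h1 := hb d.1 (hmax d hdD)
    have h2 := le_upperValue hK (subset_convexHull ℝ D hdD) le_rfl
    exact mul_nonneg (hw0 d hd) (by linarith)
  have hsum : ∑ d ∈ hD.toFinset, w d * (f p + b * (d.1 - p) - d.2) = b * (z.1 - p) := by
    have : ∀ d : ℝ × ℝ, w d * (f p + b * (d.1 - p) - d.2)
        = (f p - b * p) * w d + b * (w d * d.1) - w d * d.2 := fun d => by ring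
    simp_rw [this]
    rw [Finset.sum_sub_distrib, Finset.sum_add_distrib, ← Finset.mul_sum, ← Finset.mul_sum, hw1,
      hz1, hz2, hzv]
    ring
  have hbz : b * (z.1 - p) = 0 :=
    le_antisymm (mul_nonpos_of_nonpos_of_nonneg hb0 (by linarith))
      (hsum ▸ Finset.sum_nonneg hgap)
  have hline : ∀ d ∈ hD.toFinset, w d ≠ 0 → d.2 = f p + b * (d.1 - p) := by
    intro d hd hwd
    have h1 := (Finset.sum_eq_zero_iff_of_nonneg hgap).1 (hsum.trans hbz) d hd
    rcases mul_eq_zero.1 h1 with h | h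
    · exact absurd h hwd
    · linarith
  by_cases hleft : ∃ d ∈ hD.toFinset, w d ≠ 0 ∧ d.1 < p
  · by_cases hright : ∃ d ∈ hD.toFinset, w d ≠ 0 ∧ p < d.1
    · obtain ⟨d, hd, hwd, hdp⟩ := hleft
      obtain ⟨e, he, hwe, hep⟩ := hright
      refine ⟨f p - b * p, b, ?_⟩
      filter_upwards [Ioo_mem_nhds hdp hep] with q hq
      have heD : e ∈ D := by simpa using he
      have hdD : d ∈ D := by simpa using hd
      refine le_antisymm ?_ ?_
      · have := hb q (hq.2.le.trans (hmax e heD))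
        linarith
      · -- the point with abscissa `q` of the segment from `d` to `e`
        have hpos : 0 < e.1 - d.1 := by linarith
        have hmem := hKc (subset_convexHull ℝ D hdD) (subset_convexHull ℝ D heD)
          (show 0 ≤ (e.1 - q) / (e.1 - d.1) from div_nonneg (by linarith [hq.2]) hpos.le)
          (show 0 ≤ (q - d.1) / (e.1 - d.1) from div_nonneg (by linarith [hq.1]) hpos.le)
          (by field_simp; ring)
        have h1 : q ≤ (((e.1 - q) / (e.1 - d.1)) • d + ((q - d.1) / (e.1 - d.1)) • e).1 := by
          simp only [Prod.fst_add, Prod.smul_fst, smul_eq_mul]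
          apply le_of_eq
          field_simp
          ring
        have h2 := le_upperValue hK hmem h1
        simp only [Prod.snd_add, Prod.smul_snd, smul_eq_mul, hline d hd hwd, hline e he hwe] at h2
        refine le_of_eq_of_le ?_ h2
        field_simp
        ring
    · -- vertices at most at `p`, one of them strictly to the left, have their mean `z.1` below `p`
      exfalso
      push Not at hright
      obtain ⟨d, hd, hwd, hdp⟩ := hleft
      have h1 : ∑ d ∈ hD.toFinset, w d * d.1 < ∑ d ∈ hD.toFinset, w d * p := by
        refine Finset.sum_lt_sum (fun e he => ?_) ⟨d, hd, ?_⟩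
        · by_cases h0 : w e = 0
          · simp [h0]
          · exact mul_le_mul_of_nonneg_left (hright e he h0) (hw0 e he)
        · exact mul_lt_mul_of_pos_left hdp (lt_of_le_of_ne (hw0 d hd) (Ne.symm hwd))
      rw [hz1, ← Finset.sum_mul, hw1, one_mul] at h1
      linarith
  · push Not at hleft
    have hlt : p < z.1 := by
      have hex : ∃ d ∈ hD.toFinset, w d ≠ 0 := by
        by_contra! hall
        rw [Finset.sum_eq_zero hall] at hw1
        exact zero_ne_one hw1
      obtain ⟨d, hd, hwd⟩ := hex
      have hne : ∀ e ∈ hD.toFinset, e.1 ≠ p := fun e he => hpD e (by simpa using he)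
      have h1 : ∑ d ∈ hD.toFinset, w d * p < ∑ d ∈ hD.toFinset, w d * d.1 := by
        refine Finset.sum_lt_sum (fun e he => ?_) ⟨d, hd, ?_⟩
        · by_cases h0 : w e = 0
          · simp [h0]
          · exact mul_le_mul_of_nonneg_left (hleft e he h0) (hw0 e he)
        · exact mul_lt_mul_of_pos_left (lt_of_le_of_ne (hleft d hd hwd) (hne d hd).symm)
            (lt_of_le_of_ne (hw0 d hd) (Ne.symm hwd))
      rwa [hz1, ← Finset.sum_mul, hw1, one_mul] at h1
    have hb' : b = 0 := by
      rcases mul_eq_zero.1 hbz with h | h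
      · exact h
      · linarith
    refine ⟨f p, 0, ?_⟩
    filter_upwards [Iio_mem_nhds hlt, Iio_mem_nhds hp] with q hq hq'
    refine le_antisymm ?_ ?_
    · simpa [hb'] using hb q (le_of_lt hq')
    · have := le_upperValue hK hz (le_of_lt hq)
      linarith

end UpperValue

/-- Between two consecutive breakpoints the function is bounded by the chord: every point of
`[0, m]` is a convex combination of two breakpoints for which `f` satisfies the inequality of
convexity. -/
theorem exists_breakpoint_chord {K : Set (ℝ × ℝ)} {z₀ : ℝ × ℝ} (hK : IsCompact K) (hz₀ : z₀ ∈ K)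
    {B : Set ℝ} (hB : B.Finite) (h0 : 0 ∈ B) (hm : z₀.1 ∈ B)
    (haff : ∀ q, 0 < q → q < z₀.1 → q ∉ B → LocallyAffineAt (upperValue K) q)
    {p : ℝ} (hp0 : 0 ≤ p) (hpm : p ≤ z₀.1) :
    ∃ l ∈ B, ∃ r ∈ B, l ∈ Set.Icc 0 z₀.1 ∧ r ∈ Set.Icc 0 z₀.1 ∧ ∃ α β : ℝ, 0 ≤ α ∧ 0 ≤ β ∧
      α + β = 1 ∧ p = α * l + β * r ∧
      upperValue K p ≤ α * upperValue K l + β * upperValue K r := by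
  by_cases hpB : p ∈ B
  · exact ⟨p, hpB, p, hpB, ⟨hp0, hpm⟩, ⟨hp0, hpm⟩, 1, 0, by simp⟩
  obtain ⟨l, ⟨hlB, hlp⟩, hl⟩ := Set.exists_max_image (B ∩ Set.Iic p) id
    (hB.subset Set.inter_subset_left) ⟨0, h0, hp0⟩
  obtain ⟨r, ⟨hrB, hpr⟩, hr⟩ := Set.exists_min_image (B ∩ Set.Ici p) id
    (hB.subset Set.inter_subset_left) ⟨z₀.1, hm, hpm⟩
  have hl0 : 0 ≤ l := hl 0 ⟨h0, hp0⟩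
  have hrm : r ≤ z₀.1 := hr _ ⟨hm, hpm⟩
  have hlp' : l < p := lt_of_le_of_ne hlp fun h => hpB (h ▸ hlB)
  have hpr' : p < r := lt_of_le_of_ne hpr fun h => hpB (h ▸ hrB)
  have hlr := hlp'.trans hpr'
  have hloc : ∀ q ∈ Set.Ioo l r, LocallyAffineAt (upperValue K) q := by
    intro q hq
    refine haff q (hl0.trans_lt hq.1) (hq.2.trans_le hrm) fun hqB => ?_
    rcases le_total q p with h | h
    · exact absurd (hl q ⟨hqB, h⟩) (not_le.2 hq.1)
    · exact absurd (hr q ⟨hqB, h⟩) (not_le.2 hq.2)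
  obtain ⟨a, b, hab⟩ := exists_affine_of_locallyAffineAt hloc
  have h1 := affine_le_upperValue_left hK hz₀ hlr hrm fun q hq => (hab q hq).ge
  have h2 := affine_le_upperValue_right hK hz₀ hlr hrm fun q hq => (hab q hq).ge
  have hpos : 0 < r - l := by linarith
  have hα : 0 ≤ (r - p) / (r - l) := div_nonneg (by linarith) hpos.le
  have hβ : 0 ≤ (p - l) / (r - l) := div_nonneg (by linarith) hpos.le
  refine ⟨l, hlB, r, hrB, ⟨hl0, hlr.le.trans hrm⟩, ⟨hl0.trans hlr.le, hrm⟩,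
    (r - p) / (r - l), (p - l) / (r - l), hα, hβ, by field_simp; ring, by field_simp; ring, ?_⟩
  calc upperValue K p = a + b * p := hab p ⟨hlp', hpr'⟩
    _ = (r - p) / (r - l) * (a + b * l) + (p - l) / (r - l) * (a + b * r) := by
      field_simp; ring
    _ ≤ _ := by gcongr

/-! ### Occupancy measures of Markov policies -/

/-- The distribution that plays the action `a` with certainty. -/
noncomputable def pureAction {A : Type*} [Fintype A] (a : A) : stdSimplex ℝ A :=
  open Classical in ⟨Pi.single a 1, single_mem_stdSimplex ℝ a⟩

namespace MDP

variable {S A : Type*} [Fintype S] [Fintype A] {H : ℕ} (M : MDP S A H)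

theorem stateDist_nonneg (π : Policy S A) (s : S) (t : ℕ) (x : S) : 0 ≤ M.stateDist π s t x := by
  induction t generalizing x with
  | zero => simp only [stateDist]; split_ifs <;> norm_num
  | succ t ih =>
    exact Finset.sum_nonneg fun y _ => Finset.sum_nonneg fun a _ =>
      mul_nonneg (mul_nonneg (ih y) ((π y).2.1 a)) ((M.trans y a).2.1 x)

theorem sum_stateDist (π : Policy S A) (s : S) (t : ℕ) : ∑ x, M.stateDist π s t x = 1 := by
  induction t with
  | zero =>
    simp only [stateDist]
    classical simp
  | succ t ih =>
    simp only [stateDist]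
    rw [Finset.sum_comm, ← ih]
    refine Finset.sum_congr rfl fun y _ => ?_
    rw [Finset.sum_comm]
    simp_rw [← Finset.mul_sum, (M.trans y _).2.2, mul_one, ← Finset.mul_sum, (π y).2.2, mul_one]

theorem stateDist_le_one (π : Policy S A) (s : S) (t : ℕ) (x : S) : M.stateDist π s t x ≤ 1 :=
  (Finset.single_le_sum (fun y _ => M.stateDist_nonneg π s t y) (Finset.mem_univ x)).trans_eq
    (M.sum_stateDist π s t)

/-- Only states of the layer `t` can be reached at the time `t`. -/
theorem stateDist_eq_zero (π : Policy S A) {t : ℕ} (ht : t ≤ H) {x : S} (hx : M.layer x ≠ t) :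
    M.stateDist π M.init t x = 0 := by
  induction t generalizing x with
  | zero =>
    simp only [stateDist]
    rw [if_neg]
    rintro rfl
    exact hx M.init_layer
  | succ t ih =>
    refine Finset.sum_eq_zero fun y _ => Finset.sum_eq_zero fun a _ => ?_
    by_cases hy : M.layer y = t
    · have h0 : (M.trans y a).1 x = 0 := by
        by_contra hne
        have := M.trans_layer y a x (by omega) (lt_of_le_of_ne ((M.trans y a).2.1 x) (Ne.symm hne))
        omega
      rw [h0, mul_zero]
    · rw [ih (by omega) hy, zero_mul, zero_mul]

/-- The distribution at the time `t` only depends on the decisions in the layers before `t`. -/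
theorem stateDist_congr {π π' : Policy S A} {t : ℕ} (ht : t ≤ H)
    (h : ∀ x, M.layer x < t → π x = π' x) (x : S) :
    M.stateDist π M.init t x = M.stateDist π' M.init t x := by
  induction t generalizing x with
  | zero => rfl
  | succ t ih =>
    refine Finset.sum_congr rfl fun y _ => Finset.sum_congr rfl fun a _ => ?_
    by_cases hy : M.layer y = t
    · rw [ih (by omega) (fun z hz => h z (by omega)), h y (by omega)]
    · simp only [M.stateDist_eq_zero _ (show t ≤ H by omega) hy, zero_mul]

/-- The occupancy measure of a policy: the probability of being in the state `x` at the time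
`t ≤ H` and choosing the action `a` there. -/
noncomputable def occupancy (π : Policy S A) : Fin (H + 1) × S × A → ℝ :=
  fun z => M.stateDist π M.init z.1 z.2.1 * (π z.2.1).1 z.2.2

/-- The policy that mimics the mixture of `π₁` and `π₂` with the weights `α` and `β`: in the
state `x` it plays each action with its conditional probability, given that `x` is visited, under
the mixture.  In states that the mixture does not visit the choice is immaterial. -/
theorem exists_mixed_policy (π₁ π₂ : Policy S A) {α β : ℝ} (hα : 0 ≤ α) (hβ : 0 ≤ β) :
    ∃ π : Policy S A, ∀ x a,
      (α * M.stateDist π₁ M.init (M.layer x) x + β * M.stateDist π₂ M.init (M.layer x) x)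
          * (π x).1 a
        = α * (M.stateDist π₁ M.init (M.layer x) x * (π₁ x).1 a)
          + β * (M.stateDist π₂ M.init (M.layer x) x * (π₂ x).1 a) := by
  suffices h : ∀ x, ∃ ν : stdSimplex ℝ A, ∀ a,
      (α * M.stateDist π₁ M.init (M.layer x) x + β * M.stateDist π₂ M.init (M.layer x) x) * ν.1 a
        = α * (M.stateDist π₁ M.init (M.layer x) x * (π₁ x).1 a)
          + β * (M.stateDist π₂ M.init (M.layer x) x * (π₂ x).1 a) by
    choose π hπ using h
    exact ⟨π, hπ⟩
  intro x
  set d₁ := M.stateDist π₁ M.init (M.layer x) x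
  set d₂ := M.stateDist π₂ M.init (M.layer x) x
  have h₁ : 0 ≤ α * d₁ := mul_nonneg hα (M.stateDist_nonneg _ _ _ _)
  have h₂ : 0 ≤ β * d₂ := mul_nonneg hβ (M.stateDist_nonneg _ _ _ _)
  rcases (add_nonneg h₁ h₂).eq_or_lt with h | h
  · have e₁ : α * d₁ = 0 := by linarith
    have e₂ : β * d₂ = 0 := by linarith
    exact ⟨π₁ x, fun a => by rw [← mul_assoc, ← mul_assoc, e₁, e₂]; ring⟩
  · refine ⟨⟨fun a => (α * d₁ * (π₁ x).1 a + β * d₂ * (π₂ x).1 a) / (α * d₁ + β * d₂),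
      fun a => ?_, ?_⟩, fun a => ?_⟩
    · exact div_nonneg (add_nonneg (mul_nonneg h₁ ((π₁ x).2.1 a)) (mul_nonneg h₂ ((π₂ x).2.1 a)))
        h.le
    · rw [← Finset.sum_div, Finset.sum_add_distrib, ← Finset.mul_sum, ← Finset.mul_sum,
        (π₁ x).2.2, (π₂ x).2.2, mul_one, mul_one, div_self h.ne']
    · simp only
      rw [mul_div_cancel₀ _ h.ne']
      ring

theorem convex_range_occupancy : Convex ℝ (Set.range M.occupancy) := by
  rintro _ ⟨π₁, rfl⟩ _ ⟨π₂, rfl⟩ α β hα hβ hαβ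
  obtain ⟨π, hπ⟩ := M.exists_mixed_policy π₁ π₂ hα hβ
  have hact : ∀ t ≤ H, ∀ x a, M.stateDist π M.init t x
        = α * M.stateDist π₁ M.init t x + β * M.stateDist π₂ M.init t x →
      M.stateDist π M.init t x * (π x).1 a
        = α * (M.stateDist π₁ M.init t x * (π₁ x).1 a)
          + β * (M.stateDist π₂ M.init t x * (π₂ x).1 a) := by
    intro t ht x a hd
    by_cases hx : M.layer x = t
    · rw [hd, ← hx, hπ]
    · simp [M.stateDist_eq_zero _ ht hx]
  have hdist : ∀ t ≤ H, ∀ x, M.stateDist π M.init t x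
      = α * M.stateDist π₁ M.init t x + β * M.stateDist π₂ M.init t x := by
    intro t
    induction t with
    | zero =>
      intro _ x
      simp only [stateDist]
      rw [← add_mul, hαβ, one_mul]
    | succ t ih =>
      intro ht x
      simp only [stateDist, Finset.mul_sum, ← Finset.sum_add_distrib]
      refine Finset.sum_congr rfl fun y _ => Finset.sum_congr rfl fun a _ => ?_
      rw [hact t (by omega) y a (ih (by omega) y)]
      ring
  refine ⟨π, funext fun ⟨t, x, a⟩ => ?_⟩
  exact hact t (by omega) x a (hdist t (by omega) x)

open Classical in
/-- Inductive step of `stateDist_eq_sum_update`: if the distribution at the time `t` is affine in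
the decision at `s`, then so are the joint probabilities of states and actions. -/
theorem stateDist_mul_eq_sum_update (π : Policy S A) (s : S) {t : ℕ} (ht : t ≤ H) (x : S) (b : A)
    (hd : M.stateDist π M.init t x
      = ∑ a, (π s).1 a * M.stateDist (Function.update π s (pureAction a)) M.init t x) :
    M.stateDist π M.init t x * (π x).1 b
      = ∑ a, (π s).1 a * (M.stateDist (Function.update π s (pureAction a)) M.init t x
          * (Function.update π s (pureAction a) x).1 b) := by
  by_cases hx : x = s
  · subst hx
    have hcongr : ∀ a, M.stateDist (Function.update π x (pureAction a)) M.init t x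
        = M.stateDist π M.init t x := by
      intro a
      by_cases hl : M.layer x = t
      · refine M.stateDist_congr ht (fun y hy => ?_) x
        rw [Function.update_of_ne]
        rintro rfl
        omega
      · rw [M.stateDist_eq_zero _ ht hl, M.stateDist_eq_zero _ ht hl]
    simp only [hcongr, Function.update_self]
    rw [Finset.sum_eq_single b]
    · simp [pureAction, mul_comm]
    · intro a _ hab
      simp [pureAction, hab.symm]
    · simp
  · rw [hd, Finset.sum_mul]
    refine Finset.sum_congr rfl fun a _ => ?_
    rw [Function.update_of_ne hx, mul_assoc]

open Classical in
/-- The state distributions are affine in the decision at a single state `s`, because a state is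
visited at most once. -/
theorem stateDist_eq_sum_update (π : Policy S A) (s : S) {t : ℕ} (ht : t ≤ H) (x : S) :
    M.stateDist π M.init t x
      = ∑ a, (π s).1 a * M.stateDist (Function.update π s (pureAction a)) M.init t x := by
  induction t generalizing x with
  | zero =>
    simp only [stateDist]
    rw [← Finset.sum_mul, (π s).2.2, one_mul]
  | succ t ih =>
    simp only [stateDist, Finset.mul_sum]
    symm
    rw [Finset.sum_comm]
    refine Finset.sum_congr rfl fun y _ => ?_
    rw [Finset.sum_comm]
    refine Finset.sum_congr rfl fun b _ => ?_
    rw [M.stateDist_mul_eq_sum_update π s (by omega) y b (ih (by omega) y), Finset.sum_mul]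
    refine Finset.sum_congr rfl fun a _ => ?_
    ring

open Classical in
theorem occupancy_eq_sum_update (π : Policy S A) (s : S) :
    M.occupancy π
      = ∑ a, (π s).1 a • M.occupancy (Function.update π s (pureAction a)) := by
  ext ⟨t, x, b⟩
  rw [Finset.sum_apply]
  exact M.stateDist_mul_eq_sum_update π s (by omega) x b
    (M.stateDist_eq_sum_update π s (by omega) x)

/-- The occupancy measures are mixtures of those of the deterministic policies: the decisions are
made deterministic one state at a time. -/
theorem occupancy_mem_convexHull (π : Policy S A) :
    M.occupancy π ∈
      convexHull ℝ (Set.range fun d : S → A => M.occupancy fun s => pureAction (d s)) := by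
  classical
  suffices h : ∀ U : Finset S, ∀ π : Policy S A, (∀ s ∉ U, ∃ a, π s = pureAction a) →
      M.occupancy π ∈
        convexHull ℝ (Set.range fun d : S → A => M.occupancy fun s => pureAction (d s)) from
    h Finset.univ π fun s hs => absurd (Finset.mem_univ s) hs
  intro U
  induction U using Finset.induction_on with
  | empty =>
    intro π hπ
    choose d hd using fun s => hπ s (Finset.notMem_empty s)
    exact subset_convexHull ℝ _ ⟨d, congrArg M.occupancy (funext hd).symm⟩
  | insert s U _ ih =>
    intro π hπ
    rw [M.occupancy_eq_sum_update π s]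
    refine (convex_convexHull ℝ _).sum_mem (fun a _ => (π s).2.1 a) (π s).2.2 fun a _ => ih _ ?_
    intro x hx
    by_cases hxs : x = s
    · exact ⟨a, by rw [hxs, Function.update_self]⟩
    · rw [Function.update_of_ne hxs]
      exact hπ x (by simp [hxs, hx])

theorem value_init (π : Policy S A) :
    M.value π M.init
      = ∑ t : Fin H, ∑ x, ∑ a, M.occupancy π (t.castSucc, x, a) * M.reward x a := by
  rw [value, M.init_layer, Nat.sub_zero, Finset.sum_range]
  rfl

theorem value_init_le (π : Policy S A) :
    M.value π M.init ≤ ∑ _t : Fin H, ∑ x, ∑ a, |M.reward x a| := by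
  rw [value_init]
  refine Finset.sum_le_sum fun t _ => Finset.sum_le_sum fun x _ => Finset.sum_le_sum fun a _ => ?_
  have h0 : 0 ≤ M.occupancy π (t.castSucc, x, a) :=
    mul_nonneg (M.stateDist_nonneg _ _ _ _) ((π x).2.1 a)
  have h1 : M.occupancy π (t.castSucc, x, a) ≤ 1 := by
    refine mul_le_one₀ (M.stateDist_le_one _ _ _ _) ((π x).2.1 a) ?_
    exact (Finset.single_le_sum (fun y _ => (π x).2.1 y) (Finset.mem_univ a)).trans_eq (π x).2.2
  calc M.occupancy π (t.castSucc, x, a) * M.reward x a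
      ≤ M.occupancy π (t.castSucc, x, a) * |M.reward x a| := by gcongr; exact le_abs_self _
    _ ≤ 1 * |M.reward x a| := by gcongr
    _ = _ := one_mul _

end MDP

/-! ### The value of the provider -/

namespace ProviderMDP

variable {S A : Type*} [Fintype S] [Fintype A] {H : ℕ} (M : ProviderMDP S A H)

/-- The pair of the enabling probability at the time `T` and the value of a policy, as a linear
function of its occupancy measure. -/
noncomputable def performanceMap (T : Fin (H + 1)) : (Fin (H + 1) × S × A → ℝ) →ₗ[ℝ] ℝ × ℝ where
  toFun ρ := (∑ s, ∑ a, (if M.enabled s = true then 1 else 0) * ρ (T, s, a),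
    ∑ t : Fin H, ∑ x, ∑ a, ρ (t.castSucc, x, a) * M.reward x a)
  map_add' ρ σ := by simp [mul_add, add_mul, Finset.sum_add_distrib]
  map_smul' c ρ := by simp [Finset.mul_sum, mul_assoc]

/-- The pair of the enabling probability at the time `T` and the value of a policy. -/
noncomputable def performance (T : ℕ) (π : Policy S A) : ℝ × ℝ :=
  (M.enableProb π T, M.toMDP.value π M.init)

theorem performanceMap_occupancy (T : Fin (H + 1)) (π : Policy S A) :
    M.performanceMap T (M.occupancy π) = M.performance T π := by
  refine Prod.ext ?_ (M.toMDP.value_init π).symm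
  refine Finset.sum_congr rfl fun s _ => ?_
  simp only [MDP.occupancy]
  rw [← Finset.mul_sum, ← Finset.mul_sum, (π s).2.2]
  split_ifs <;> simp

/-- The attainable pairs of enabling probability and value form a polygon, whose vertices belong
to deterministic policies. -/
theorem range_performance {T : ℕ} (hT : T ≤ H) :
    Set.range (M.performance T) =
      convexHull ℝ (Set.range fun d : S → A => M.performance T fun s => pureAction (d s)) := by
  have himage : ∀ π, M.performance T π = M.performanceMap ⟨T, by omega⟩ (M.occupancy π) :=
    fun π => (M.performanceMap_occupancy ⟨T, by omega⟩ π).symm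
  apply Set.Subset.antisymm
  · rintro _ ⟨π, rfl⟩
    have h := Set.mem_image_of_mem (M.performanceMap ⟨T, by omega⟩)
      (M.toMDP.occupancy_mem_convexHull π)
    rw [LinearMap.image_convexHull, ← Set.range_comp] at h
    simpa only [himage, Function.comp_def] using h
  · refine convexHull_min ?_ ?_
    · rintro _ ⟨d, rfl⟩
      exact ⟨_, rfl⟩
    · have h := M.toMDP.convex_range_occupancy.linear_image (M.performanceMap ⟨T, by omega⟩)
      rw [← Set.range_comp] at h
      rwa [show M.performance T = M.performanceMap ⟨T, by omega⟩ ∘ M.occupancy from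
        funext himage]

theorem commitmentValue_eq_upperValue (T : ℕ) :
    M.commitmentValue T = upperValue (Set.range (M.performance T)) := by
  ext p
  simp [commitmentValue, upperValue, performance]

theorem enableProb_nonneg (π : Policy S A) (T : ℕ) : 0 ≤ M.enableProb π T :=
  Finset.sum_nonneg fun s _ => by
    split_ifs
    · exact M.stateDist_nonneg _ _ _ _
    · exact le_rfl

theorem enableProb_le_one (π : Policy S A) (T : ℕ) : M.enableProb π T ≤ 1 := by
  rw [← M.sum_stateDist π M.init T]
  refine Finset.sum_le_sum fun s _ => ?_
  split_ifs
  · exact le_rfl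
  · exact M.stateDist_nonneg _ _ _ _

theorem bddAbove_enableProb (T : ℕ) :
    BddAbove (Set.range fun π : Policy S A => M.enableProb π T) :=
  ⟨1, by rintro _ ⟨π, rfl⟩; exact M.enableProb_le_one π T⟩

theorem isCompact_range_performance {T : ℕ} (hT : T ≤ H) :
    IsCompact (Set.range (M.performance T)) := by
  rw [M.range_performance hT]
  exact (Set.finite_range _).isCompact_convexHull ℝ

variable [Nonempty A]

theorem exists_enableProb_eq_maxProb {T : ℕ} (hT : T ≤ H) :
    ∃ π : Policy S A, M.enableProb π T = M.maxProb T := by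
  have hne : (Set.range (M.performance T)).Nonempty :=
    ⟨_, fun _ => pureAction (Classical.arbitrary A), rfl⟩
  obtain ⟨_, ⟨π, rfl⟩, hπ⟩ :=
    (M.isCompact_range_performance hT).exists_isMaxOn hne continuous_fst.continuousOn
  refine ⟨π, le_antisymm (le_ciSup (M.bddAbove_enableProb T) π) ?_⟩
  have : Nonempty (Policy S A) := ⟨π⟩
  exact ciSup_le fun π' => hπ (Set.mem_range_self π')

theorem feasible_iff (c : Commitment H) : M.Feasible c ↔ (c.2 : ℝ) ≤ M.maxProb (c.1 : ℕ) := by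
  constructor
  · rintro ⟨π, hπ⟩
    exact hπ.trans (le_ciSup (M.bddAbove_enableProb _) π)
  · intro h
    obtain ⟨π, hπ⟩ := M.exists_enableProb_eq_maxProb c.1.2.2
    exact ⟨π, h.trans_eq hπ.symm⟩

theorem maxProb_mem_Icc {T : ℕ} (hT : T ≤ H) : M.maxProb T ∈ Set.Icc (0 : ℝ) 1 := by
  obtain ⟨π, hπ⟩ := M.exists_enableProb_eq_maxProb hT
  exact hπ ▸ ⟨M.enableProb_nonneg π T, M.enableProb_le_one π T⟩

theorem feasible_of_mem_breakpointCommitments {c : Commitment H}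
    (hc : c ∈ M.breakpointCommitments) : M.Feasible c := by
  rw [feasible_iff]
  rcases hc with h | h | h
  · rw [h]
    exact (M.maxProb_mem_Icc c.1.2.2).1
  · exact h.le
  · exact h.2.1.le

theorem finite_breakpoints {T : ℕ} (hT : T ≤ H) : (M.breakpoints T).Finite := by
  obtain ⟨π, hπ⟩ := M.exists_enableProb_eq_maxProb hT
  have hfin : (Set.range fun d : S → A => M.performance T fun s => pureAction (d s)).Finite :=
    Set.finite_range _
  refine ((hfin.image Prod.fst).insert (M.maxProb T) |>.insert 0).subset ?_
  rintro p (rfl | rfl | ⟨hp0, hpm, hp⟩)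
  · exact Set.mem_insert _ _
  · exact Set.mem_insert_of_mem _ (Set.mem_insert _ _)
  · refine Set.mem_insert_of_mem _ (Set.mem_insert_of_mem _ ?_)
    by_contra hpD
    refine hp ?_
    have hz₀ : M.performance T π ∈ Set.range (M.performance T) := ⟨π, rfl⟩
    rw [M.range_performance hT] at hz₀
    rw [M.commitmentValue_eq_upperValue, M.range_performance hT]
    refine upperValue_locallyAffineAt hfin hz₀ (hpm.trans_eq hπ.symm) ?_ ?_
    · rintro _ ⟨d, rfl⟩
      exact (le_ciSup (M.bddAbove_enableProb T) _).trans_eq hπ.symm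
    · intro z hz hzp
      exact hpD ⟨z, hz, hzp⟩

theorem finite_breakpointCommitments : M.breakpointCommitments.Finite := by
  have h : ∀ T : Set.Icc 1 H, {p : Set.Icc (0 : ℝ) 1 | (p : ℝ) ∈ M.breakpoints T}.Finite :=
    fun T => (M.finite_breakpoints T.2.2).preimage Subtype.val_injective.injOn
  refine (Set.finite_iUnion fun T => (h T).image (Prod.mk T)).subset fun c hc => ?_
  exact Set.mem_iUnion.2 ⟨c.1, c.2, hc, rfl⟩

/-- Every feasible commitment lies between two breakpoint commitments for the same time, and the
value of the provider satisfies the inequality of convexity there. -/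
theorem exists_breakpointCommitments_chord {c : Commitment H} (hc : M.Feasible c) :
    ∃ l r : Set.Icc (0 : ℝ) 1, (c.1, l) ∈ M.breakpointCommitments ∧
      (c.1, r) ∈ M.breakpointCommitments ∧ ∃ α β : ℝ, 0 ≤ α ∧ 0 ≤ β ∧ α + β = 1 ∧
        (c.2 : ℝ) = α * l + β * r ∧
        M.commitmentValue c.1 c.2 ≤ α * M.commitmentValue c.1 l + β * M.commitmentValue c.1 r := by
  have hT : (c.1 : ℕ) ≤ H := c.1.2.2
  obtain ⟨π, hπ⟩ := M.exists_enableProb_eq_maxProb hT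
  have hm1 := (M.maxProb_mem_Icc hT).2
  obtain ⟨l, hl, r, hr, hlI, hrI, α, β, hα, hβ, hαβ, hp, hle⟩ :=
    exists_breakpoint_chord (z₀ := M.performance c.1 π) (M.isCompact_range_performance hT) ⟨π, rfl⟩
      (M.finite_breakpoints hT) (Or.inl rfl) (Or.inr (Or.inl hπ))
      (by
        intro q hq0 hqm hq
        by_contra hna
        refine hq (Or.inr (Or.inr ⟨hq0, hqm.trans_eq hπ, ?_⟩))
        rwa [M.commitmentValue_eq_upperValue])
      c.2.2.1 (((M.feasible_iff c).1 hc).trans_eq hπ.symm)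
  rw [show (M.performance c.1 π).1 = M.maxProb c.1 from hπ] at hlI hrI
  refine ⟨⟨l, hlI.1, hlI.2.trans hm1⟩, ⟨r, hrI.1, hrI.2.trans hm1⟩, hl, hr, α, β, hα, hβ, hαβ,
    hp, ?_⟩
  rw [M.commitmentValue_eq_upperValue]
  exact hle

end ProviderMDP

/-! ### The value of the recipient -/

section SingleBranch

variable {H : ℕ} (T : Set.Icc 1 H)

/-- Away from the transition into the time `T` the influence ignores the probability. -/
theorem singleBranch_eq_of_ne (p q : Set.Icc (0 : ℝ) 1) {t : ℕ} (ht : t + 1 ≠ (T : ℕ)) (u : Bool) :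
    singleBranch (T, p) t u = singleBranch (T, q) t u := by
  simp [singleBranch, ht]

theorem singleBranch_affine {p q r : Set.Icc (0 : ℝ) 1} {α β : ℝ} (hαβ : α + β = 1)
    (hp : (p : ℝ) = α * q + β * r) (t : ℕ) (u u' : Bool) :
    (singleBranch (T, p) t u).1 u'
      = α * (singleBranch (T, q) t u).1 u' + β * (singleBranch (T, r) t u).1 u' := by
  obtain rfl : β = 1 - α := by linarith
  simp only [singleBranch]
  split_ifs <;> (try rw [hp]) <;> ring

end SingleBranch

namespace RecipientMDP

variable {L A : Type*} [Fintype L] [Fintype A] {H : ℕ} (M : RecipientMDP L A H) (T : Set.Icc 1 H)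

theorem stateDist_eq_of_lt (p q : Set.Icc (0 : ℝ) 1) (π : Policy (L × Bool) A) {t : ℕ}
    (ht : t < (T : ℕ)) (x : L × Bool) :
    (M.toMDP (singleBranch (T, p))).stateDist π (M.init, false) t x
      = (M.toMDP (singleBranch (T, q))).stateDist π (M.init, false) t x := by
  induction t generalizing x with
  | zero => rfl
  | succ t ih =>
    have hTH : (T : ℕ) ≤ H := T.2.2
    refine Finset.sum_congr rfl fun y _ => Finset.sum_congr rfl fun a _ => ?_
    rw [ih (by omega)]
    by_cases hy : M.layer y.1 = t
    · congr 1
      simp only [toMDP]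
      rw [hy, singleBranch_eq_of_ne T p q ht.ne]
    · rw [show (M.toMDP (singleBranch (T, q))).stateDist π (M.init, false) t y = 0 from
        (M.toMDP (singleBranch (T, q))).stateDist_eq_zero π (by omega) hy]
      simp only [zero_mul]

/-- For a fixed policy the state distributions are affine in the probability of the commitment:
the probability enters only once, in the transition into the time `T`. -/
theorem stateDist_affine {p q r : Set.Icc (0 : ℝ) 1} {α β : ℝ} (hαβ : α + β = 1)
    (hp : (p : ℝ) = α * q + β * r) (π : Policy (L × Bool) A) {t : ℕ} (ht : t ≤ H)
    (x : L × Bool) :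
    (M.toMDP (singleBranch (T, p))).stateDist π (M.init, false) t x
      = α * (M.toMDP (singleBranch (T, q))).stateDist π (M.init, false) t x
        + β * (M.toMDP (singleBranch (T, r))).stateDist π (M.init, false) t x := by
  induction t generalizing x with
  | zero =>
    simp only [MDP.stateDist]
    rw [← add_mul, hαβ, one_mul]
  | succ t ih =>
    simp only [MDP.stateDist, Finset.mul_sum, ← Finset.sum_add_distrib]
    refine Finset.sum_congr rfl fun y _ => Finset.sum_congr rfl fun a _ => ?_
    by_cases hy : M.layer y.1 = t
    · by_cases hT : t + 1 = (T : ℕ)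
      · rw [M.stateDist_eq_of_lt T q p π (by omega), M.stateDist_eq_of_lt T r p π (by omega)]
        simp only [toMDP]
        rw [singleBranch_affine T hαβ hp]
        ring
      · rw [ih (by omega)]
        simp only [toMDP]
        rw [hy, singleBranch_eq_of_ne T q p hT, singleBranch_eq_of_ne T r p hT]
        ring
    · have h0 : ∀ s, (M.toMDP (singleBranch (T, s))).stateDist π (M.init, false) t y = 0 :=
        fun s => (M.toMDP (singleBranch (T, s))).stateDist_eq_zero π (by omega) hy
      simp only [h0, zero_mul, mul_zero, add_zero]

theorem value_affine {p q r : Set.Icc (0 : ℝ) 1} {α β : ℝ} (hαβ : α + β = 1)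
    (hp : (p : ℝ) = α * q + β * r) (π : Policy (L × Bool) A) :
    (M.toMDP (singleBranch (T, p))).value π (M.toMDP (singleBranch (T, p))).init
      = α * (M.toMDP (singleBranch (T, q))).value π (M.toMDP (singleBranch (T, q))).init
        + β * (M.toMDP (singleBranch (T, r))).value π (M.toMDP (singleBranch (T, r))).init := by
  simp only [MDP.value_init, Finset.mul_sum, ← Finset.sum_add_distrib]
  refine Finset.sum_congr rfl fun t _ => Finset.sum_congr rfl fun x _ =>
    Finset.sum_congr rfl fun a _ => ?_
  have h := M.stateDist_affine T hαβ hp π (t := t) (by omega) x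
  simp only [MDP.occupancy, Fin.val_castSucc]
  simp only [toMDP] at h ⊢
  rw [h]
  ring

theorem bddAbove_value (c : Commitment H) :
    BddAbove (Set.range fun π : Policy (L × Bool) A =>
      (M.toMDP (singleBranch c)).value π (M.toMDP (singleBranch c)).init) :=
  ⟨_, by rintro _ ⟨π, rfl⟩; exact MDP.value_init_le _ π⟩

/-- As a supremum of affine functions, the value of the recipient is convex in the probability of
the commitment. -/
theorem commitmentValue_le_chord [Nonempty A] {p q r : Set.Icc (0 : ℝ) 1} {α β : ℝ} (hα : 0 ≤ α)
    (hβ : 0 ≤ β) (hαβ : α + β = 1) (hp : (p : ℝ) = α * q + β * r) :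
    M.commitmentValue (T, p) ≤ α * M.commitmentValue (T, q) + β * M.commitmentValue (T, r) := by
  have : Nonempty (Policy (L × Bool) A) := ⟨fun _ => pureAction (Classical.arbitrary A)⟩
  refine ciSup_le fun π => ?_
  rw [M.value_affine T hαβ hp π]
  exact add_le_add
    (mul_le_mul_of_nonneg_left (le_ciSup (M.bddAbove_value (T, q)) π) hα)
    (mul_le_mul_of_nonneg_left (le_ciSup (M.bddAbove_value (T, r)) π) hβ)

end RecipientMDP

/-! ### Expected utility of selection -/

section Query

variable {ι K : Type*} [Fintype ι] {k : ℕ} {v : ι → K → ℝ} {μ : ι → ℝ}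

theorem existsUnique_isResponse [NeZero k] (w : K → ℝ) (Q : Fin k → K) :
    ∃! j, IsResponse w Q j := by
  classical
  obtain ⟨j₀, hj₀⟩ := Finite.exists_max fun j => w (Q j)
  obtain ⟨j, hj, hmin⟩ := Set.exists_min_image {j | ∀ j', w (Q j') ≤ w (Q j)} id
    (Set.toFinite _) ⟨j₀, hj₀⟩
  refine ⟨j, ⟨hj, fun j' hlt => ?_⟩, fun i hi => ?_⟩
  · by_contra! hle
    exact absurd (hmin j' fun i => (hj i).trans hle) (not_le.2 hlt)
  · refine le_antisymm ?_ (hmin i hi.1)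
    by_contra! hlt
    exact absurd (hi.2 j hlt) (not_lt.2 (hj i))

/-- Since the recipient maximizes the joint value, the expected utility of selection is the
expectation of the best joint value in the query. -/
theorem EUS_eq_sum_iSup [NeZero k] (hμ : ∀ i, 0 ≤ μ i) (Q : Fin k → K) :
    EUS v μ Q = ∑ i, μ i * ⨆ j, v i (Q j) := by
  classical
  have hjoint : ∀ j i, responseProb v μ Q j * posterior v μ Q j i = responseJoint v μ Q j i := by
    intro j i
    by_cases h : responseProb v μ Q j = 0
    · have h0 : ∀ i ∈ Finset.univ, 0 ≤ responseJoint v μ Q j i := fun i _ => by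
        unfold responseJoint
        split_ifs
        · exact hμ i
        · exact le_rfl
      rw [h, zero_mul, (Finset.sum_eq_zero_iff_of_nonneg h0).1 h i (Finset.mem_univ i)]
    · rw [posterior, mul_div_cancel₀ _ h]
  simp only [EUS, EU, Finset.mul_sum, ← mul_assoc, hjoint]
  rw [Finset.sum_comm]
  refine Finset.sum_congr rfl fun i _ => ?_
  obtain ⟨j, hj, huniq⟩ := existsUnique_isResponse (v i) Q
  have hsup : ⨆ j, v i (Q j) = v i (Q j) :=
    le_antisymm (ciSup_le hj.1) (le_ciSup (f := fun j => v i (Q j)) (Set.finite_range _).bddAbove j)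
  rw [hsup, Finset.sum_eq_single j]
  · rw [responseJoint, if_pos hj]
  · intro j' _ hne
    rw [responseJoint, if_neg fun h => hne (huniq j' h), zero_mul]
  · simp

theorem EUS_le_of_range_subset [NeZero k] (hμ : ∀ i, 0 ≤ μ i) {Q Q' : Fin k → K}
    (h : Set.range Q ⊆ Set.range Q') : EUS v μ Q ≤ EUS v μ Q' := by
  rw [EUS_eq_sum_iSup hμ, EUS_eq_sum_iSup hμ]
  refine Finset.sum_le_sum fun i _ => mul_le_mul_of_nonneg_left (ciSup_le fun j => ?_) (hμ i)
  obtain ⟨j', hj'⟩ := h ⟨j, rfl⟩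
  rw [← hj']
  exact le_ciSup (f := fun j => v i (Q' j)) (Set.finite_range _).bddAbove j'

open Classical in
/-- The maximum over the query is convex in each of its entries. -/
theorem EUS_le_chord [NeZero k] (hμ : ∀ i, 0 ≤ μ i) (Q : Fin k → K) (j : Fin k) {c d : K}
    {α β : ℝ} (hα : 0 ≤ α) (hβ : 0 ≤ β) (hαβ : α + β = 1)
    (h : ∀ i, v i (Q j) ≤ α * v i c + β * v i d) :
    EUS v μ Q ≤ α * EUS v μ (Function.update Q j c) + β * EUS v μ (Function.update Q j d) := by
  simp only [EUS_eq_sum_iSup hμ, Finset.mul_sum, ← Finset.sum_add_distrib]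
  refine Finset.sum_le_sum fun i _ => ?_
  have hle : ∀ c j', v i (Function.update Q j c j') ≤ ⨆ j', v i (Function.update Q j c j') :=
    fun c => le_ciSup (Set.finite_range _).bddAbove
  have hsup : ⨆ j', v i (Q j') ≤ α * (⨆ j', v i (Function.update Q j c j'))
      + β * ⨆ j', v i (Function.update Q j d j') := by
    refine ciSup_le fun j' => ?_
    have hc := mul_le_mul_of_nonneg_left (hle c j') hα
    have hd := mul_le_mul_of_nonneg_left (hle d j') hβ
    by_cases hj : j' = j
    · subst hj
      simp only [Function.update_self] at hc hd
      linarith [h i]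
    · simp only [Function.update_of_ne hj] at hc hd
      have : v i (Q j') = α * v i (Q j') + β * v i (Q j') := by rw [← add_mul, hαβ, one_mul]
      linarith
  calc μ i * ⨆ j', v i (Q j') ≤ μ i * _ := mul_le_mul_of_nonneg_left hsup (hμ i)
    _ = _ := by ring

/-- If each element of `F` lies on a chord between two elements of `C` along which all the joint
values satisfy the inequality of convexity, then queries from `C` are as good as queries
from `F`. -/
theorem exists_EUS_le_of_chord [NeZero k] (hμ : ∀ i, 0 ≤ μ i) {F C : Set K}
    (hchord : ∀ x ∈ F, ∃ c ∈ C, ∃ d ∈ C, ∃ α β : ℝ, 0 ≤ α ∧ 0 ≤ β ∧ α + β = 1 ∧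
      ∀ i, v i x ≤ α * v i c + β * v i d) (Q : Fin k → K) (hQ : ∀ j, Q j ∈ F) :
    ∃ Q' : Fin k → K, (∀ j, Q' j ∈ C) ∧ EUS v μ Q ≤ EUS v μ Q' := by
  classical
  suffices h : ∀ U : Finset (Fin k), ∃ Q' : Fin k → K, (∀ j ∈ U, Q' j ∈ C) ∧
      (∀ j ∉ U, Q' j ∈ F) ∧ EUS v μ Q ≤ EUS v μ Q' by
    obtain ⟨Q', hQ', -, hle⟩ := h Finset.univ
    exact ⟨Q', fun j => hQ' j (Finset.mem_univ j), hle⟩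
  intro U
  induction U using Finset.induction_on with
  | empty => exact ⟨Q, by simp, fun j _ => hQ j, le_rfl⟩
  | insert j U hj ih =>
    obtain ⟨Q', hC, hF, hle⟩ := ih
    obtain ⟨c, hc, d, hd, α, β, hα, hβ, hαβ, h⟩ := hchord (Q' j) (hF j hj)
    have hmem : ∀ e ∈ C, (∀ j' ∈ insert j U, Function.update Q' j e j' ∈ C) ∧
        ∀ j' ∉ insert j U, Function.update Q' j e j' ∈ F := by
      refine fun e he => ⟨fun j' hj' => ?_, fun j' hj' => ?_⟩
      · by_cases hjj : j' = j
        · rwa [hjj, Function.update_self]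
        · rw [Function.update_of_ne hjj]
          exact hC j' (Finset.mem_of_mem_insert_of_ne hj' hjj)
      · rw [Finset.mem_insert, not_or] at hj'
        rw [Function.update_of_ne hj'.1]
        exact hF j' hj'.2
    have hmix := hle.trans (EUS_le_chord hμ Q' j hα hβ hαβ h)
    -- a convex combination is at most one of the two combined values
    rcases le_total (EUS v μ (Function.update Q' j c)) (EUS v μ (Function.update Q' j d))
      with hcd | hcd
    · refine ⟨_, (hmem d hd).1, (hmem d hd).2, hmix.trans ?_⟩
      have h1 := mul_le_mul_of_nonneg_left hcd hα
      have h2 : ∀ y : ℝ, α * y + β * y = y := fun y => by rw [← add_mul, hαβ, one_mul]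
      linarith [h2 (EUS v μ (Function.update Q' j d))]
    · refine ⟨_, (hmem c hc).1, (hmem c hc).2, hmix.trans ?_⟩
      have h1 := mul_le_mul_of_nonneg_left hcd hβ
      have h2 : ∀ y : ℝ, α * y + β * y = y := fun y => by rw [← add_mul, hαβ, one_mul]
      linarith [h2 (EUS v μ (Function.update Q' j c))]

/-- A query from a set with at least `k` elements can be improved to one with `k` distinct
entries, by replacing repetitions with further elements. -/
theorem exists_embedding_EUS_le [NeZero k] (hμ : ∀ i, 0 ≤ μ i) {C : Set K}
    (hk : (k : ℕ∞) ≤ C.encard) (Q : Fin k → K) (hQ : ∀ j, Q j ∈ C) :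
    ∃ Q' : Fin k ↪ K, (∀ j, Q' j ∈ C) ∧ EUS v μ Q ≤ EUS v μ Q' := by
  have hcard : (Set.range Q).encard ≤ k := by
    rw [← Set.image_univ]
    refine (Set.encard_image_le _ _).trans ?_
    simp [Set.encard_univ]
  obtain ⟨E, hQE, hEC, hE⟩ :=
    Set.exists_superset_subset_encard_eq (Set.range_subset_iff.2 hQ) hcard hk
  have hfin : E.Finite := Set.finite_of_encard_eq_coe hE
  have : Fintype E := hfin.fintype
  have hEk : Fintype.card E = k := by
    rw [Set.encard_eq_coe_toFinset_card, Set.toFinset_card] at hE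
    exact_mod_cast hE
  let e : Fin k ≃ E := (Fintype.equivFinOfCardEq hEk).symm
  refine ⟨e.toEmbedding.trans (Function.Embedding.subtype _), fun j => hEC (e j).2,
    EUS_le_of_range_subset hμ fun x hx => ⟨e.symm ⟨x, hQE hx⟩, by simp⟩⟩

end Query

/-- If each value attained on a larger class of queries is dominated by a value attained on a
finite nonempty smaller class, then both classes have the same maximum. -/
theorem exists_isGreatest_of_dominated {X Y : Set ℝ} (hY : Y.Finite) (hne : Y.Nonempty)
    (hYX : Y ⊆ X) (hdom : ∀ x ∈ X, ∃ y ∈ Y, x ≤ y) : ∃ m, IsGreatest X m ∧ IsGreatest Y m := by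
  obtain ⟨m, hm, hmax⟩ := Set.exists_max_image Y id hY hne
  refine ⟨m, ⟨hYX hm, fun x hx => ?_⟩, hm, fun y hy => hmax y hy⟩
  obtain ⟨y, hy, hxy⟩ := hdom x hx
  exact hxy.trans (hmax y hy)

/-- The provider's value is affine and the recipients' values are convex between two consecutive
breakpoints, so that all the joint values are convex there. -/
theorem jointValue_chord {S A : Type*} [Fintype S] [Fintype A] [Nonempty A] {H : ℕ}
    (P : ProviderMDP S A H) {ι : Type*} {L B : ι → Type*} [∀ i, Fintype (L i)]
    [∀ i, Fintype (B i)] [∀ i, Nonempty (B i)] (R : ∀ i, RecipientMDP (L i) (B i) H)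
    {c : Commitment H} (hc : P.Feasible c) :
    ∃ d ∈ P.breakpointCommitments, ∃ e ∈ P.breakpointCommitments, ∃ α β : ℝ, 0 ≤ α ∧ 0 ≤ β ∧
      α + β = 1 ∧
      ∀ i, jointValue P (R i) c ≤ α * jointValue P (R i) d + β * jointValue P (R i) e := by
  obtain ⟨l, r, hl, hr, α, β, hα, hβ, hαβ, hp, hle⟩ := P.exists_breakpointCommitments_chord hc
  refine ⟨_, hl, _, hr, α, β, hα, hβ, hαβ, fun i => ?_⟩
  have h := (R i).commitmentValue_le_chord c.1 hα hβ hαβ hp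
  simp only [jointValue]
  linarith

/-! ### Optimal queries -/

theorem theorem5 {S A : Type*} [Fintype S] [Fintype A] [Nonempty A] {H : ℕ} (hH : 1 ≤ H)
    (P : ProviderMDP S A H)
    {ι : Type*} [Fintype ι] {L B : ι → Type*} [∀ i, Fintype (L i)] [∀ i, Fintype (B i)]
    [∀ i, Nonempty (B i)] (R : ∀ i, RecipientMDP (L i) (B i) H)
    (μ : ι → ℝ) (hμ : μ ∈ stdSimplex ℝ ι) (k : ℕ) (hk : 1 ≤ k) :
    -- queries of exactly `k` distinct commitments, when such queries can be drawn from the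
    -- breakpoint commitments
    ((k : ℕ∞) ≤ P.breakpointCommitments.encard →
      ∃ m : ℝ,
        IsGreatest {x | ∃ Q : Fin k ↪ Commitment H, (∀ j, P.Feasible (Q j)) ∧
          EUS (fun i => jointValue P (R i)) μ Q = x} m ∧
        IsGreatest {x | ∃ Q : Fin k ↪ Commitment H, (∀ j, Q j ∈ P.breakpointCommitments) ∧
          EUS (fun i => jointValue P (R i)) μ Q = x} m) ∧
    -- every `k`, for queries in which commitments may be repeated
    ∃ m : ℝ,
      IsGreatest {x | ∃ Q : Fin k → Commitment H, (∀ j, P.Feasible (Q j)) ∧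
        EUS (fun i => jointValue P (R i)) μ Q = x} m ∧
      IsGreatest {x | ∃ Q : Fin k → Commitment H, (∀ j, Q j ∈ P.breakpointCommitments) ∧
        EUS (fun i => jointValue P (R i)) μ Q = x} m := by
  have : NeZero k := ⟨by omega⟩
  have hμ0 : ∀ i, 0 ≤ μ i := hμ.1
  have hfeas : ∀ c ∈ P.breakpointCommitments, P.Feasible c :=
    fun c hc => P.feasible_of_mem_breakpointCommitments hc
  have hdom : ∀ Q : Fin k → Commitment H, (∀ j, P.Feasible (Q j)) →
      ∃ Q' : Fin k → Commitment H, (∀ j, Q' j ∈ P.breakpointCommitments) ∧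
        EUS (fun i => jointValue P (R i)) μ Q ≤ EUS (fun i => jointValue P (R i)) μ Q' :=
    fun Q hQ => exists_EUS_le_of_chord (F := {c | P.Feasible c}) hμ0
      (fun c hc => jointValue_chord P R hc) Q hQ
  have hfin : {x | ∃ Q : Fin k → Commitment H, (∀ j, Q j ∈ P.breakpointCommitments) ∧
      EUS (fun i => jointValue P (R i)) μ Q = x}.Finite :=
    (Set.Finite.pi' fun _ : Fin k => P.finite_breakpointCommitments).image
      (EUS (fun i => jointValue P (R i)) μ)
  -- the trivial commitment `(1, 0)` is a breakpoint commitment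
  let c₀ : Commitment H := (⟨1, le_rfl, hH⟩, ⟨0, le_rfl, zero_le_one⟩)
  have hc₀ : c₀ ∈ P.breakpointCommitments := Or.inl rfl
  refine ⟨fun hcard => exists_isGreatest_of_dominated (hfin.subset ?_) ?_ ?_ ?_,
    exists_isGreatest_of_dominated hfin ⟨_, fun _ => c₀, fun _ => hc₀, rfl⟩ ?_ ?_⟩
  · rintro _ ⟨Q, hQ, rfl⟩
    exact ⟨Q, hQ, rfl⟩
  · obtain ⟨Q, hQ, -⟩ := exists_embedding_EUS_le (v := fun i => jointValue P (R i)) hμ0 hcard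
      (fun _ => c₀) fun _ => hc₀
    exact ⟨_, Q, hQ, rfl⟩
  · rintro _ ⟨Q, hQ, rfl⟩
    exact ⟨Q, fun j => hfeas _ (hQ j), rfl⟩
  · rintro _ ⟨Q, hQ, rfl⟩
    obtain ⟨Q', hQ', hle⟩ := hdom Q hQ
    obtain ⟨Q'', hQ'', hle'⟩ := exists_embedding_EUS_le (v := fun i => jointValue P (R i)) hμ0
      hcard Q' hQ'
    exact ⟨_, ⟨Q'', hQ'', rfl⟩, hle.trans hle'⟩
  · rintro _ ⟨Q, hQ, rfl⟩
    exact ⟨Q, fun j => hfeas _ (hQ j), rfl⟩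
  · rintro _ ⟨Q, hQ, rfl⟩
    obtain ⟨Q', hQ', hle⟩ := hdom Q hQ
    exact ⟨_, ⟨Q', hQ', rfl⟩, hle⟩
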